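/- Let $\mathcal X$ be a finite field with $q$ elements and let $G$ be an invertible lower triangular $\ell\times\ell$ matrix over $\mathcal X$ (rows and columns indexed by $0,\dots,\ell-1$) that is not diagonal. Let $W:\mathcal X\to\mathcal Y$ be a discrete memoryless channel with an at most countable output alphabet $\mathcal Y$. Its symmetric capacity is $$I(W)=\sum_{x\in\mathcal X}\sum_{y\in\mathcal Y}\frac1q W(y\mid x)\log_q\frac{W(y\mid x)}{\frac1q\sum_{x'\in\mathcal X}W(y\mid x')},$$ and for $0\le i<\ell$ its subchannel $W^{(i)}:\mathcal X\to\mathcal Y^\ell\times\mathcal X^{i}$ under the linear kernel $u\mapsto uG$ is $$W^{(i)}(y_0^{\ell-1},u_0^{i-1}\mid u_i)=\frac1{q^{\ell-1}}\sum_{u_{i+1}^{\ell-1}\in\mathcal X^{\ell-1-i}}\ \prod_{j=0}^{\ell-1}W\bigl(y_j\mid (u_0^{\ell-1}G)_j\bigr).$$ Let $B_1,B_2,\dots$ be independent random variables, each uniformly distributed on $\{0,\dots,\ell-1\}$, and let $W^{(B_1)\cdots(B_n)}=(\cdots(W^{(B_1)})\cdots)^{(B_n)}$. Let $k$ be the largest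 index such that the $k$-th row of $G$ has more than one nonzero entry. If there is $j\in\{0,\dots,k-1\}$ such that $G_{kj}/G_{kk}$ is a primitive element of $\mathcal X$ (a generator of the multiplicative group $\mathcal X^\times$), then $I(W^{(B_1)\cdots(B_n)})$ converges almost surely, as $n\to\infty$, to a random variable $I_\infty$ with $$P\bigl(I_\infty\in\{0,1\}\bigr)=1 .$$ -/

import Mathlib

open MeasureTheory ProbabilityTheory Filter Topology

universe u

/-- A discrete memoryless channel with finite input alphabet `X` and an (at most) countable
output alphabet `Out`; `prob x y` is the transition probability `W(y ∣ x)`. -/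
structure DMC (X : Type u) where
  Out : Type u
  countable_out : Countable Out
  prob : X → Out → ℝ
  prob_nonneg : ∀ x y, 0 ≤ prob x y
  prob_hasSum : ∀ x, HasSum (prob x) 1

namespace DMC

/-- The symmetric capacity `I(W)`, with logarithms to base `q = |X|`
(`0 * log 0 = 0`, as usual). -/
noncomputable def symCapacity {X : Type u} [Fintype X] (W : DMC X) : ℝ :=
  ∑ x : X, ∑' y : W.Out,
    1 / (Fintype.card X : ℝ) * W.prob x y *
      Real.logb (Fintype.card X : ℝ)
        (W.prob x y / (1 / (Fintype.card X : ℝ) * ∑ x' : X, W.prob x' y))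

/-- The memoryless extension `W^ℓ(y ∣ x) = ∏ j, W(y j ∣ x j)`. -/
def powProb {X : Type u} (W : DMC X) {ℓ : ℕ} (x : Fin ℓ → X) (y : Fin ℓ → W.Out) : ℝ :=
  ∏ j, W.prob (x j) (y j)

/-- The transition probabilities `W^{(i)}(y, p ∣ a)` of the `i`-th subchannel under the kernel `g`:
the output is `y` together with the past inputs `p = (u_0, …, u_{i-1})`, the input is `a = u_i`,
and the sum runs over the future inputs `u_{i+1}, …, u_{ℓ-1}`, that is, over all `u` which agree
with `p` before `i` and with `a` at `i`. -/
noncomputable def subProb {X : Type u} [Fintype X] [DecidableEq X] {ℓ : ℕ}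
    (g : (Fin ℓ → X) → (Fin ℓ → X)) (W : DMC X) (i : Fin ℓ) (a : X)
    (o : (Fin ℓ → W.Out) × ({j : Fin ℓ // j < i} → X)) : ℝ :=
  1 / (Fintype.card X : ℝ) ^ (ℓ - 1) *
    ∑ u : Fin ℓ → X with (∀ j : {j : Fin ℓ // j < i}, u j = o.2 j) ∧ u i = a,
      W.powProb (g u) o.1

theorem powProb_nonneg {X : Type u} (W : DMC X) {ℓ : ℕ} (x : Fin ℓ → X) (y : Fin ℓ → W.Out) :
    0 ≤ W.powProb x y :=
  Finset.prod_nonneg fun _ _ => W.prob_nonneg _ _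

theorem powProb_hasSum {X : Type u} (W : DMC X) :
    ∀ {ℓ : ℕ} (x : Fin ℓ → X), HasSum (W.powProb x) 1 := by
  intro ℓ
  induction ℓ with
  | zero =>
    intro x
    have h := hasSum_fintype (W.powProb x)
    simpa [powProb] using h
  | succ n ih =>
    intro x
    have h1 := W.prob_hasSum (x 0)
    have h2 := ih (fun j : Fin n => x j.succ)
    have h3 : Summable fun z : W.Out × (Fin n → W.Out) =>
        W.prob (x 0) z.1 * W.powProb (fun j : Fin n => x j.succ) z.2 :=
      h1.summable.mul_of_nonneg h2.summable (W.prob_nonneg _) (W.powProb_nonneg _)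
    have h4 := h1.mul h2 h3
    rw [← (Fin.consEquiv fun _ : Fin (n + 1) => W.Out).hasSum_iff, ← mul_one (1 : ℝ)]
    refine h4.congr_fun ?_
    intro z
    simp [powProb, Fin.prod_univ_succ, Fin.consEquiv]

theorem card_filter_eq {X : Type u} [Fintype X] [DecidableEq X] {ℓ : ℕ} (i : Fin ℓ) (a : X) :
    (Finset.univ.filter fun u : Fin ℓ → X => u i = a).card = Fintype.card X ^ (ℓ - 1) := by
  have h : (Finset.univ.filter fun u : Fin ℓ → X => u i = a) =
      Fintype.piFinset fun j => if j = i then {a} else Finset.univ := by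
    ext u
    simp only [Finset.mem_filter, Finset.mem_univ, true_and, Fintype.mem_piFinset]
    constructor
    · intro h j
      by_cases hj : j = i
      · subst hj; simp [h]
      · simp [hj]
    · intro h
      simpa using h i
  rw [h, Fintype.card_piFinset, ← Finset.mul_prod_erase _ _ (Finset.mem_univ i)]
  rw [Finset.prod_congr rfl (g := fun _ => Fintype.card X)]
  · simp
  · intro j hj
    simp [Finset.ne_of_mem_erase hj]

theorem subProb_hasSum {X : Type u} [Fintype X] [DecidableEq X] {ℓ : ℕ}
    (g : (Fin ℓ → X) → (Fin ℓ → X)) (W : DMC X) (i : Fin ℓ) (a : X) :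
    HasSum (subProb g W i a) 1 := by
  have key : ∀ u ∈ Finset.univ.filter (fun u : Fin ℓ → X => u i = a),
      HasSum (fun o : (Fin ℓ → W.Out) × ({j : Fin ℓ // j < i} → X) =>
        if ∀ j : {j : Fin ℓ // j < i}, u j = o.2 j then W.powProb (g u) o.1 else 0) 1 := by
    intro u _
    have hinj : Function.Injective (fun y : Fin ℓ → W.Out =>
        (y, fun j : {j : Fin ℓ // j < i} => u j)) := fun y y' h => (Prod.ext_iff.1 h).1
    rw [← hinj.hasSum_iff]
    · simpa [Function.comp_def] using W.powProb_hasSum (g u)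
    · rintro ⟨y, p⟩ ho
      refine if_neg fun h => ho ⟨y, ?_⟩
      exact Prod.ext rfl (funext h)
  have h := (hasSum_sum key).mul_left (1 / (Fintype.card X : ℝ) ^ (ℓ - 1))
  have hX : (Fintype.card X : ℝ) ≠ 0 := by
    have : Nonempty X := ⟨a⟩
    exact_mod_cast Fintype.card_ne_zero
  have h1 : 1 / (Fintype.card X : ℝ) ^ (ℓ - 1) *
      ∑ _u ∈ Finset.univ.filter (fun u : Fin ℓ → X => u i = a), (1 : ℝ) = 1 := by
    rw [Finset.sum_const, card_filter_eq]
    simp [hX]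
  rw [h1] at h
  refine h.congr_fun fun o => ?_
  rw [subProb, ← Finset.sum_filter, Finset.filter_filter]
  simp only [and_comm]

/-- The `i`-th subchannel `W^{(i)}` of `W` under the kernel `g`. -/
noncomputable def sub {X : Type u} [Fintype X] [DecidableEq X] {ℓ : ℕ}
    (g : (Fin ℓ → X) → (Fin ℓ → X)) (W : DMC X) (i : Fin ℓ) : DMC X where
  Out := (Fin ℓ → W.Out) × ({j : Fin ℓ // j < i} → X)
  countable_out := by
    have := W.countable_out
    infer_instance
  prob := subProb g W i
  prob_nonneg a o := mul_nonneg (by positivity)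
    (Finset.sum_nonneg fun _ _ => W.powProb_nonneg _ _)
  prob_hasSum a := subProb_hasSum g W i a

/-- The channel obtained from `W` after `n` transforms, with indices `b 0, …, b (n - 1)`. -/
noncomputable def iter {X : Type u} [Fintype X] [DecidableEq X] {ℓ : ℕ}
    (g : (Fin ℓ → X) → (Fin ℓ → X)) (W : DMC X) (b : ℕ → Fin ℓ) : ℕ → DMC X
  | 0 => W
  | n + 1 => sub g (iter g W b n) (b n)

end DMC

/-- The linear kernel `u ↦ u G` (row vectors) represented by the matrix `G`. -/
def linearKernel {X : Type u} [Field X] {ℓ : ℕ} (G : Matrix (Fin ℓ) (Fin ℓ) X) :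
    (Fin ℓ → X) → (Fin ℓ → X) :=
  fun u => Matrix.vecMul u G

/-- `a` is a primitive element of the finite field `X`: its powers are exactly the nonzero
elements of `X`. -/
def IsPrimitiveElement {X : Type u} [Field X] (a : X) : Prop :=
  a ≠ 0 ∧ ∀ b : X, b ≠ 0 → ∃ n : ℕ, a ^ n = b

/-!
The capacities `I(W^{(B_1)⋯(B_n)})` form a martingale with values in `[0, 1]`, because a bijective
kernel preserves the total conditional entropy of the input given the output
(`DMC.sum_condEnt_sub`, from the chain rule `sum_sum_ent_prefix`). Hence they converge almost
surely. The index `k` occurs infinitely often, so it remains to see that a channel whose `k`-th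
subchannel has almost the same capacity is itself nearly useless or nearly perfect, uniformly over
all channels (`DMC.exists_symCapacity_le_or_ge`).

The rows of `G` below the `k`-th are diagonal, so the input `u_k` acts on the position `k` through
`G_kk u_k` alone and on the position `j` through `c + G_kj u_k`, where `c` is a function of the
past inputs. The capacity gained by the `k`-th subchannel is the divergence between the posterior
of `u_k` given everything and its posterior given `y_k` only. By a form of Pinsker's inequality
(`mul_log_sub_log_ge`) a small gain makes an `L¹` distance small, and integrating against a test
function of `y_j` alone turns this into the smallness of `S(a, b) * T(γ (a - b))` for `a ≠ b`
(`DMC.exists_overlap_mul_shiftDist_le`). Here `γ = G_kj / G_kk`; the overlap `S(a, b)` is the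
probability that two independent samples from the posterior of the input given the output are `a`
and `b`; and `T(d)` is the `L¹` effect on the joint distribution of shifting the input by `d`.

With `S(d) = ∑ c, S(c + d, c)` one has `S(d) + T(d) ≥ 1 / q`, since a posterior that is invariant
under the shift by `d` charges pairs of inputs differing by `d`. So if `T(d)` is small for one
`d ≠ 0`, then `S(d)` is not, hence `T(γ d)` is small, and inductively `T(γ^n d)` is small for all
`n ≥ 1`; as `γ` is primitive, `T` is small everywhere, the posteriors are nearly uniform, and the
capacity is close to `0`. Otherwise `T` is bounded below at all nonzero shifts, so `S` is small at
all of them, the posteriors are nearly concentrated at single inputs, and the capacity is close to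
`1`.
-/

/-! ### Entropy of nonnegative weights -/

/-- The entropy, in natural units, of a finite family `f` of nonnegative weights that need not sum
to one: `∑ f log (∑ f / f)`, homogeneous of degree one in `f`. -/
noncomputable def ent {α : Type*} [Fintype α] (f : α → ℝ) : ℝ :=
  ∑ x, f x * (Real.log (∑ x', f x') - Real.log (f x))

/-- A strengthening of `f log (f / g) ≥ f - g` by a multiple of `|f - g|`; summed over an alphabet
it is a form of Pinsker's inequality in which `θ` remains to be optimised. -/
theorem mul_log_sub_log_ge {f g θ : ℝ} (hf : 0 ≤ f) (hg : 0 ≤ g) (h : g = 0 → f = 0) :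
    f - g + 2 * θ * (|f - g| - θ * (f + g)) ≤ f * (Real.log f - Real.log g) := by
  obtain ⟨a, ha, rfl⟩ : ∃ a, 0 ≤ a ∧ f = a ^ 2 := ⟨√f, Real.sqrt_nonneg f, (Real.sq_sqrt hf).symm⟩
  obtain ⟨b, hb, rfl⟩ : ∃ a, 0 ≤ a ∧ g = a ^ 2 := ⟨√g, Real.sqrt_nonneg g, (Real.sq_sqrt hg).symm⟩
  have h1 : 2 * θ * (|a ^ 2 - b ^ 2| - θ * (a ^ 2 + b ^ 2)) ≤ (a - b) ^ 2 := by
    have : |a ^ 2 - b ^ 2| = |a - b| * (a + b) := by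
      rw [show a ^ 2 - b ^ 2 = (a - b) * (a + b) by ring, abs_mul,
        abs_of_nonneg (add_nonneg ha hb)]
    rw [this]
    have := sq_abs (a - b)
    nlinarith [sq_nonneg (|a - b| - θ * (a + b)), sq_nonneg (θ * (a - b))]
  -- The logarithm is bounded through square roots: `log (g / f) ≤ 2 (√(g / f) - 1)`.
  have h2 : a ^ 2 - b ^ 2 + (a - b) ^ 2 ≤ a ^ 2 * (Real.log (a ^ 2) - Real.log (b ^ 2)) := by
    rcases eq_or_lt_of_le ha with rfl | ha'
    · simp
    rcases eq_or_lt_of_le hb with rfl | hb'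
    · simp at h; exact absurd h ha'.ne'
    have := Real.log_le_sub_one_of_pos (div_pos hb' ha')
    rw [Real.log_div hb'.ne' ha'.ne'] at this
    rw [Real.log_pow, Real.log_pow]
    have h3 := mul_le_mul_of_nonneg_left this (sq_nonneg a)
    have h4 : a ^ 2 * (b / a - 1) = a * b - a ^ 2 := by field_simp
    push_cast
    nlinarith
  linarith

theorem mul_log_sub_log_ge_sub {f g : ℝ} (hf : 0 ≤ f) (hg : 0 ≤ g) (h : g = 0 → f = 0) :
    f - g ≤ f * (Real.log f - Real.log g) := by
  simpa using mul_log_sub_log_ge (θ := 0) hf hg h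

theorem ent_term_nonneg {f s : ℝ} (hf : 0 ≤ f) (hs : f ≤ s) :
    0 ≤ f * (Real.log s - Real.log f) := by
  rcases eq_or_lt_of_le hf with rfl | hf'
  · simp
  · exact mul_nonneg hf (sub_nonneg.2 (Real.log_le_log hf' hs))

theorem ent_term_le {f s : ℝ} (hf : 0 ≤ f) (hs : f ≤ s) :
    f * (Real.log s - Real.log f) ≤ s := by
  have := mul_log_sub_log_ge_sub hf (hf.trans hs) (fun h => le_antisymm (h ▸ hs) hf)
  linarith

theorem ent_nonneg {α : Type*} [Fintype α] {f : α → ℝ} (hf : ∀ x, 0 ≤ f x) : 0 ≤ ent f :=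
  Finset.sum_nonneg fun x _ => ent_term_nonneg (hf x)
    (Finset.single_le_sum (fun x _ => hf x) (Finset.mem_univ x))

theorem ent_le_card_mul {α : Type*} [Fintype α] {f : α → ℝ} (hf : ∀ x, 0 ≤ f x) :
    ent f ≤ Fintype.card α * ∑ x, f x := by
  refine (Finset.sum_le_sum fun x _ => ent_term_le (hf x)
    (Finset.single_le_sum (fun x _ => hf x) (Finset.mem_univ x))).trans ?_
  simp

theorem ent_comp_bijective {α : Type*} [Fintype α] (f : α → ℝ) {g : α → α}
    (hg : Function.Bijective g) : ent (fun u => f (g u)) = ent f := by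
  unfold ent
  rw [hg.sum_comp f]
  exact hg.sum_comp fun x => f x * (Real.log (∑ x', f x') - Real.log (f x))

/-! ### Joint distribution, conditional entropy and capacity of a channel -/

namespace DMC

section Basics

variable {X : Type u} [Fintype X]

/-- The joint probability of the input `x`, taken uniformly distributed, and the output `y`. -/
noncomputable def joint (W : DMC X) (y : W.Out) (x : X) : ℝ := W.prob x y / Fintype.card X

/-- The probability of the output `y` under the uniform input distribution. -/
noncomputable def outProb (W : DMC X) (y : W.Out) : ℝ := ∑ x, W.joint y x

/-- The posterior probability of the input `x` given the output `y` (zero if `y` has probability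
zero). -/
noncomputable def post (W : DMC X) (y : W.Out) (x : X) : ℝ := W.joint y x / W.outProb y

/-- The conditional entropy, in natural units, of a uniform input given the output. -/
noncomputable def condEnt (W : DMC X) : ℝ := ∑' y, ent (W.joint y)

theorem joint_nonneg (W : DMC X) (y : W.Out) (x : X) : 0 ≤ W.joint y x :=
  div_nonneg (W.prob_nonneg x y) (Nat.cast_nonneg _)

theorem outProb_nonneg (W : DMC X) (y : W.Out) : 0 ≤ W.outProb y :=
  Finset.sum_nonneg fun x _ => W.joint_nonneg y x

theorem joint_le_outProb (W : DMC X) (y : W.Out) (x : X) : W.joint y x ≤ W.outProb y :=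
  Finset.single_le_sum (fun x _ => W.joint_nonneg y x) (Finset.mem_univ x)

theorem joint_eq_zero_of_outProb (W : DMC X) {y : W.Out} (h : W.outProb y = 0) (x : X) :
    W.joint y x = 0 :=
  le_antisymm (h ▸ W.joint_le_outProb y x) (W.joint_nonneg y x)

theorem post_nonneg (W : DMC X) (y : W.Out) (x : X) : 0 ≤ W.post y x :=
  div_nonneg (W.joint_nonneg y x) (W.outProb_nonneg y)

theorem post_le_one (W : DMC X) (y : W.Out) (x : X) : W.post y x ≤ 1 :=
  div_le_one_of_le₀ (W.joint_le_outProb y x) (W.outProb_nonneg y)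

theorem outProb_mul_post (W : DMC X) (y : W.Out) (x : X) :
    W.outProb y * W.post y x = W.joint y x := by
  rw [post]
  by_cases h : W.outProb y = 0
  · simp [h, W.joint_eq_zero_of_outProb h]
  · field_simp

theorem outProb_mul_sum_post (W : DMC X) (y : W.Out) :
    W.outProb y * ∑ x, W.post y x = W.outProb y := by
  simp_rw [Finset.mul_sum, outProb_mul_post]; rfl

theorem sum_post_le_one (W : DMC X) (y : W.Out) : ∑ x, W.post y x ≤ 1 := by
  by_cases h : W.outProb y = 0
  · simp [post, h]
  · exact (mul_left_cancel₀ h ((W.outProb_mul_sum_post y).trans (mul_one _).symm)).le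

theorem joint_hasSum (W : DMC X) (x : X) :
    HasSum (fun y => W.joint y x) (1 / Fintype.card X) :=
  (W.prob_hasSum x).div_const _

theorem outProb_hasSum [Nonempty X] (W : DMC X) : HasSum W.outProb 1 := by
  have := hasSum_sum (s := Finset.univ) fun x (_ : x ∈ Finset.univ) => W.joint_hasSum x
  have h1 : ∑ _x : X, 1 / (Fintype.card X : ℝ) = 1 := by simp
  rwa [h1] at this

theorem ent_joint_summable [Nonempty X] (W : DMC X) : Summable fun y => ent (W.joint y) :=
  Summable.of_nonneg_of_le (fun y => ent_nonneg (W.joint_nonneg y))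
    (fun y => ent_le_card_mul (W.joint_nonneg y)) (W.outProb_hasSum.summable.mul_left _)

theorem condEnt_hasSum [Nonempty X] (W : DMC X) :
    HasSum (fun y => ent (W.joint y)) W.condEnt := W.ent_joint_summable.hasSum

theorem ent_joint (W : DMC X) (y : W.Out) : ent (W.joint y) =
    ∑ x, W.joint y x * (Real.log (W.outProb y) - Real.log (W.joint y x)) := rfl

theorem condEnt_nonneg (W : DMC X) : 0 ≤ W.condEnt :=
  tsum_nonneg fun y => ent_nonneg (W.joint_nonneg y)

theorem symCapacity_eq [Nontrivial X] (W : DMC X) :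
    W.symCapacity = 1 - W.condEnt / Real.log (Fintype.card X) := by
  have hq : (Fintype.card X : ℝ) ≠ 0 := by exact_mod_cast Fintype.card_ne_zero
  have hlog : Real.log (Fintype.card X) ≠ 0 :=
    (Real.log_pos (by exact_mod_cast Fintype.one_lt_card)).ne'
  have hterm : ∀ x y, 1 / (Fintype.card X : ℝ) * W.prob x y *
      Real.logb (Fintype.card X : ℝ)
        (W.prob x y / (1 / (Fintype.card X : ℝ) * ∑ x' : X, W.prob x' y)) =
      W.joint y x - W.joint y x * (Real.log (W.outProb y) - Real.log (W.joint y x)) /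
        Real.log (Fintype.card X) := by
    intro x y
    have h1 : 1 / (Fintype.card X : ℝ) * ∑ x' : X, W.prob x' y = W.outProb y := by
      simp only [outProb, joint, ← Finset.sum_div]; ring
    have h2 : W.prob x y = Fintype.card X * W.joint y x := by
      rw [joint]; field_simp
    rw [h1, h2]
    by_cases hj : W.joint y x = 0
    · simp [hj]
    have ho : W.outProb y ≠ 0 := fun h => hj (W.joint_eq_zero_of_outProb h x)
    rw [Real.logb, Real.log_div (mul_ne_zero hq hj) ho, Real.log_mul hq hj]
    field_simp
    ring
  have hsum : ∀ x, Summable fun y =>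
      W.joint y x * (Real.log (W.outProb y) - Real.log (W.joint y x)) := fun x =>
    Summable.of_nonneg_of_le
      (fun y => ent_term_nonneg (W.joint_nonneg y x) (W.joint_le_outProb y x))
      (fun y => ent_term_le (W.joint_nonneg y x) (W.joint_le_outProb y x))
      W.outProb_hasSum.summable
  have h : HasSum (fun y => ∑ x, (W.joint y x - W.joint y x *
      (Real.log (W.outProb y) - Real.log (W.joint y x)) / Real.log (Fintype.card X)))
      (1 - W.condEnt / Real.log (Fintype.card X)) := by
    simp only [Finset.sum_sub_distrib, ← Finset.sum_div]
    exact W.outProb_hasSum.sub (W.condEnt_hasSum.div_const _)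
  rw [← h.tsum_eq, Summable.tsum_finsetSum, symCapacity]
  · simp only [hterm]
  · exact fun x _ => (W.joint_hasSum x).summable.sub ((hsum x).div_const _)

theorem symCapacity_le_one [Nontrivial X] (W : DMC X) : W.symCapacity ≤ 1 := by
  rw [symCapacity_eq]
  have := div_nonneg W.condEnt_nonneg
    (Real.log_nonneg (by exact_mod_cast Fintype.card_pos (α := X)) :
      0 ≤ Real.log (Fintype.card X))
  linarith

/-- The deficit of the conditional entropy from its maximal value `log q`, as a sum over the
outputs of divergences of the joint weights from the constant weight. -/
theorem log_card_sub_condEnt_hasSum [Nontrivial X] (W : DMC X) :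
    HasSum (fun y => ∑ x, W.joint y x *
      (Real.log (W.joint y x) - Real.log (W.outProb y / Fintype.card X)))
      (Real.log (Fintype.card X) - W.condEnt) := by
  have hq : (Fintype.card X : ℝ) ≠ 0 := by exact_mod_cast Fintype.card_ne_zero
  have h := (W.outProb_hasSum.mul_right (Real.log (Fintype.card X))).sub W.condEnt_hasSum
  rw [one_mul] at h
  refine h.congr_fun fun y => ?_
  rw [ent_joint, outProb, Finset.sum_mul, ← Finset.sum_sub_distrib]
  refine Finset.sum_congr rfl fun x _ => ?_
  change _ = W.joint y x * _ - W.joint y x * (Real.log (W.outProb y) - _)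
  change W.joint y x * (_ - Real.log (W.outProb y / _)) = _
  by_cases hj : W.joint y x = 0
  · simp [hj]
  have ho : W.outProb y ≠ 0 := fun h => hj (W.joint_eq_zero_of_outProb h x)
  rw [Real.log_div ho hq]
  ring

theorem joint_eq_zero_of_outProb_div (W : DMC X) (y : W.Out) (x : X)
    (h : W.outProb y / Fintype.card X = 0) : W.joint y x = 0 := by
  have hq : (Fintype.card X : ℝ) ≠ 0 := by
    have : Nonempty X := ⟨x⟩
    exact_mod_cast Fintype.card_ne_zero
  exact W.joint_eq_zero_of_outProb ((div_eq_zero_iff.1 h).resolve_right hq) x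

theorem symCapacity_nonneg [Nontrivial X] (W : DMC X) : 0 ≤ W.symCapacity := by
  have hlog : 0 < Real.log (Fintype.card X) :=
    Real.log_pos (by exact_mod_cast Fintype.one_lt_card)
  have hq : (Fintype.card X : ℝ) ≠ 0 := by exact_mod_cast Fintype.card_ne_zero
  rw [symCapacity_eq, sub_nonneg, div_le_one hlog, ← sub_nonneg]
  refine W.log_card_sub_condEnt_hasSum.nonneg fun y => ?_
  have h : ∑ x, (W.joint y x - W.outProb y / Fintype.card X) = 0 := by
    rw [Finset.sum_sub_distrib]
    simp only [Finset.sum_const, Finset.card_univ, nsmul_eq_mul]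
    rw [mul_div_cancel₀ _ hq, sub_eq_zero, outProb]
  change 0 ≤ _
  rw [← h]
  exact Finset.sum_le_sum fun x _ => mul_log_sub_log_ge_sub (W.joint_nonneg y x)
    (div_nonneg (W.outProb_nonneg y) (Nat.cast_nonneg _)) (W.joint_eq_zero_of_outProb_div y x)

end Basics

end DMC

/-! ### Sums of products over finite powers of an alphabet -/

theorem hasSum_pi_prod_fin {Y : Type*} : ∀ {n : ℕ} (a : Fin n → Y → ℝ) (s : Fin n → ℝ),
    (∀ i, HasSum (a i) (s i)) → HasSum (fun y : Fin n → Y => ∏ i, a i (y i)) (∏ i, s i) := by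
  intro n
  induction n with
  | zero =>
    intro a s _
    simp
  | succ n ih =>
    intro a s h
    have h1 := h 0
    have h2 := ih (fun i => a i.succ) (fun i => s i.succ) fun i => h i.succ
    have h3 : Summable fun z : Y × (Fin n → Y) => a 0 z.1 * ∏ i : Fin n, a i.succ (z.2 i) :=
      summable_mul_of_summable_norm (f := a 0)
        (g := fun z : Fin n → Y => ∏ i : Fin n, a i.succ (z i))
        (summable_norm_iff.2 h1.summable) (summable_norm_iff.2 h2.summable)
    have h4 := h1.mul h2 h3
    rw [← (Fin.consEquiv fun _ : Fin (n + 1) => Y).hasSum_iff, Fin.prod_univ_succ]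
    refine h4.congr_fun ?_
    intro z
    simp [Fin.prod_univ_succ, Fin.consEquiv]

theorem sum_pi_prod {X : Type*} [Fintype X] {n : ℕ} (e : Fin n → X → ℝ) :
    ∑ x : Fin n → X, ∏ i, e i (x i) = ∏ i, ∑ x, e i x :=
  (hasSum_fintype _).unique
    (hasSum_pi_prod_fin e (fun i => ∑ x, e i x) fun i => hasSum_fintype (e i))

theorem prod_mul_single {ι : Type*} [Fintype ι] [DecidableEq ι] (f : ι → ℝ) (i : ι) (t : ℝ) :
    ∏ j, f j * (if j = i then t else 1) = (∏ j, f j) * t := by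
  rw [Finset.prod_mul_distrib]; simp

/-! ### The chain rule for entropy -/

section Chain

variable {X : Type*} [Fintype X] [DecidableEq X] {ℓ : ℕ}

/-- The total weight of the vectors that agree with `v` in the first `n` coordinates. -/
noncomputable def prefixSum (F : (Fin ℓ → X) → ℝ) (n : ℕ) (v : Fin ℓ → X) : ℝ :=
  ∑ u with ∀ j : Fin ℓ, j.val < n → u j = v j, F u

theorem prefixSum_zero (F : (Fin ℓ → X) → ℝ) (v : Fin ℓ → X) : prefixSum F 0 v = ∑ u, F u := by
  simp [prefixSum]

theorem prefixSum_self (F : (Fin ℓ → X) → ℝ) (v : Fin ℓ → X) : prefixSum F ℓ v = F v := by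
  simp [prefixSum, ← funext_iff, Finset.filter_eq']

theorem prefixSum_succ (F : (Fin ℓ → X) → ℝ) (i : Fin ℓ) (v : Fin ℓ → X)
    (p : {j : Fin ℓ // j < i} → X) (a : X) (hp : ∀ j : {j : Fin ℓ // j < i}, v j = p j)
    (ha : v i = a) :
    prefixSum F (i + 1) v =
      ∑ u with (∀ j : {j : Fin ℓ // j < i}, u j = p j) ∧ u i = a, F u := by
  unfold prefixSum
  congr 1
  ext u
  simp only [Finset.mem_filter, Finset.mem_univ, true_and]
  constructor
  · intro h
    exact ⟨fun j => (h j (Nat.lt_succ_of_lt j.2)).trans (hp j), (h i (Nat.lt_succ_self _)).trans ha⟩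
  · rintro ⟨h1, h2⟩ j hj
    rcases lt_or_eq_of_le (Nat.lt_succ_iff.1 hj) with h | h
    · exact (h1 ⟨j, h⟩).trans (hp ⟨j, h⟩).symm
    · rw [Fin.ext h, h2, ha]

theorem prefixSum_eq_sum (F : (Fin ℓ → X) → ℝ) (i : Fin ℓ) (v : Fin ℓ → X)
    (p : {j : Fin ℓ // j < i} → X) (hp : ∀ j : {j : Fin ℓ // j < i}, v j = p j) :
    prefixSum F i v =
      ∑ a, ∑ u with (∀ j : {j : Fin ℓ // j < i}, u j = p j) ∧ u i = a, F u := by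
  unfold prefixSum
  simp_rw [← Finset.filter_filter]
  rw [Finset.sum_fiberwise]
  congr 1
  ext u
  simp only [Finset.mem_filter, Finset.mem_univ, true_and]
  exact ⟨fun h j => (h j j.2).trans (hp j), fun h j hj => (h ⟨j, hj⟩).trans (hp ⟨j, hj⟩).symm⟩

/-- Summation over all vectors, grouped by the coordinates before `i` and the coordinate `i`. -/
theorem sum_prefix_fiberwise (h : (Fin ℓ → X) → ℝ) (i : Fin ℓ) :
    ∑ p : {j : Fin ℓ // j < i} → X, ∑ a,
      ∑ u with (∀ j : {j : Fin ℓ // j < i}, u j = p j) ∧ u i = a, h u = ∑ u, h u := by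
  rw [← Finset.sum_fiberwise Finset.univ (fun u (j : {j : Fin ℓ // j < i}) => u j) h]
  refine Finset.sum_congr rfl fun p _ => ?_
  simp_rw [← Finset.filter_filter]
  rw [Finset.sum_fiberwise]
  simp only [funext_iff]

theorem sum_ent_prefix (F : (Fin ℓ → X) → ℝ) (i : Fin ℓ) :
    ∑ p : {j : Fin ℓ // j < i} → X,
      ent (fun a => ∑ u with (∀ j : {j : Fin ℓ // j < i}, u j = p j) ∧ u i = a, F u) =
    ∑ v, F v * (Real.log (prefixSum F i v) - Real.log (prefixSum F (i + 1) v)) := by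
  rw [← sum_prefix_fiberwise _ i]
  refine Finset.sum_congr rfl fun p _ => ?_
  rw [ent]
  refine Finset.sum_congr rfl fun a _ => ?_
  rw [Finset.sum_mul]
  refine Finset.sum_congr rfl fun v hv => ?_
  obtain ⟨h1, h2⟩ := (Finset.mem_filter.1 hv).2
  rw [prefixSum_succ F i v p a h1 h2, prefixSum_eq_sum F i v p h1]

/-- Chain rule: the entropies of the successive coordinates, each given the preceding ones, add up
to the entropy of the vector. -/
theorem sum_sum_ent_prefix (F : (Fin ℓ → X) → ℝ) :
    ∑ i : Fin ℓ, ∑ p : {j : Fin ℓ // j < i} → X,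
      ent (fun a => ∑ u with (∀ j : {j : Fin ℓ // j < i}, u j = p j) ∧ u i = a, F u) =
    ent F := by
  simp_rw [sum_ent_prefix]
  rw [Finset.sum_comm, ent]
  refine Finset.sum_congr rfl fun v _ => ?_
  rw [← Finset.mul_sum, Fin.sum_univ_eq_sum_range
    (fun n => Real.log (prefixSum F n v) - Real.log (prefixSum F (n + 1) v)),
    Finset.sum_range_sub', prefixSum_zero, prefixSum_self]

end Chain

namespace DMC

section SubChannel

variable {X : Type u} [Fintype X] {ℓ : ℕ}

/-- The joint probability of a uniform input vector `x` and the output `y` of the memoryless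
extension. -/
noncomputable def powJoint (W : DMC X) (y : Fin ℓ → W.Out) (x : Fin ℓ → X) : ℝ :=
  ∏ j, W.joint (y j) (x j)

theorem sum_powJoint (W : DMC X) (y : Fin ℓ → W.Out) :
    ∑ x, W.powJoint y x = ∏ j, W.outProb (y j) :=
  sum_pi_prod fun j x => W.joint (y j) x

/-- The expectation, under `ℓ` independent uses of the channel, of a function of the input and the
output at the single position `i`. -/
theorem hasSum_powJoint_mul [Nonempty X] (W : DMC X) (i : Fin ℓ) (t : W.Out → X → ℝ) {c : ℝ}
    (ht : HasSum (fun y => ∑ x, W.joint y x * t y x) c) :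
    HasSum (fun y : Fin ℓ → W.Out => ∑ x : Fin ℓ → X, W.powJoint y x * t (y i) (x i)) c := by
  have h := hasSum_pi_prod_fin
    (fun (j : Fin ℓ) (y : W.Out) => ∑ x, W.joint y x * if j = i then t y x else 1)
    (fun j => if j = i then c else 1) fun j => by
      by_cases hj : j = i
      · simpa [hj] using ht
      · simpa [hj] using! W.outProb_hasSum
  rw [Finset.prod_ite_eq' Finset.univ i fun _ => c, if_pos (Finset.mem_univ i)] at h
  refine h.congr_fun fun y => ?_
  rw [← sum_pi_prod]
  refine Finset.sum_congr rfl fun x _ => ?_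
  rw [powJoint, ← prod_mul_single _ i]
  refine Finset.prod_congr rfl fun j _ => ?_
  by_cases hj : j = i
  · simp [hj]
  · simp [hj]

/-- The entropy of a vector with independent coordinates is the sum of the entropies of its
coordinates. -/
theorem ent_powJoint (W : DMC X) (y : Fin ℓ → W.Out) :
    ent (W.powJoint y) = ∑ i, ∑ x : Fin ℓ → X, W.powJoint y x *
      (Real.log (W.outProb (y i)) - Real.log (W.joint (y i) (x i))) := by
  rw [Finset.sum_comm, ent]
  refine Finset.sum_congr rfl fun x _ => ?_
  rw [← Finset.mul_sum]
  by_cases hx : W.powJoint y x = 0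
  · simp [hx]
  congr 1
  have hj : ∀ j, W.joint (y j) (x j) ≠ 0 := fun j h => hx (Finset.prod_eq_zero (Finset.mem_univ j) h)
  have ho : ∀ j, W.outProb (y j) ≠ 0 := fun j h => hj j (W.joint_eq_zero_of_outProb h _)
  rw [sum_powJoint, powJoint, Real.log_prod fun j _ => hj j, Real.log_prod fun j _ => ho j,
    Finset.sum_sub_distrib]

theorem condEnt_hasSum' [Nonempty X] (W : DMC X) :
    HasSum (fun y => ∑ x, W.joint y x * (Real.log (W.outProb y) - Real.log (W.joint y x)))
      W.condEnt := W.condEnt_hasSum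

variable [DecidableEq X]

theorem sub_joint (g : (Fin ℓ → X) → (Fin ℓ → X)) (W : DMC X) (i : Fin ℓ)
    (y : Fin ℓ → W.Out) (p : {j : Fin ℓ // j < i} → X) (a : X) :
    (sub g W i).joint (y, p) a =
      ∑ u : Fin ℓ → X with (∀ j : {j : Fin ℓ // j < i}, u j = p j) ∧ u i = a,
        W.powJoint y (g u) := by
  change subProb g W i a (y, p) / _ = _
  rw [subProb, mul_div_right_comm, Finset.mul_sum]
  refine Finset.sum_congr rfl fun u _ => ?_
  have hq : (Fintype.card X : ℝ) ≠ 0 := by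
    have : Nonempty X := ⟨a⟩
    exact_mod_cast Fintype.card_ne_zero
  obtain ⟨n, rfl⟩ : ∃ n, ℓ = n + 1 := ⟨ℓ - 1, by have := i.2; omega⟩
  simp only [powJoint, joint, powProb, Finset.prod_div_distrib, Finset.prod_const,
    Finset.card_univ, Fintype.card_fin, Nat.add_sub_cancel]
  field_simp
  ring

/-- The conditional entropy of a subchannel as a sum over the outputs of the memoryless extension
only. -/
theorem sub_condEnt_hasSum [Nonempty X] (g : (Fin ℓ → X) → (Fin ℓ → X)) (W : DMC X) (i : Fin ℓ) :
    HasSum (fun y : Fin ℓ → W.Out => ∑ p : {j : Fin ℓ // j < i} → X,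
      ent ((sub g W i).joint (y, p))) (sub g W i).condEnt :=
  (sub g W i).condEnt_hasSum.prod_fiberwise fun _ => hasSum_fintype _

/-- A bijective kernel preserves the total conditional entropy. -/
theorem sum_condEnt_sub [Nonempty X] (g : (Fin ℓ → X) → (Fin ℓ → X)) (hg : Function.Bijective g)
    (W : DMC X) : ∑ i, (sub g W i).condEnt = ℓ * W.condEnt := by
  have h1 := hasSum_sum (s := Finset.univ) fun i (_ : i ∈ Finset.univ) => sub_condEnt_hasSum g W i
  have h2 := hasSum_sum (s := Finset.univ) fun (i : Fin ℓ) (_ : i ∈ Finset.univ) =>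
    W.hasSum_powJoint_mul i _ W.condEnt_hasSum'
  simp only [Finset.sum_const, Finset.card_univ, Fintype.card_fin, nsmul_eq_mul] at h2
  refine h1.unique (h2.congr_fun fun y => ?_)
  rw [← ent_powJoint, ← ent_comp_bijective _ hg, ← sum_sum_ent_prefix]
  refine Finset.sum_congr rfl fun i _ => Finset.sum_congr rfl fun p _ => ?_
  congr 1
  exact funext fun a => sub_joint g W i y p a

theorem sum_symCapacity_sub [Nontrivial X] (g : (Fin ℓ → X) → (Fin ℓ → X))
    (hg : Function.Bijective g) (W : DMC X) :
    ∑ i, (sub g W i).symCapacity = ℓ * W.symCapacity := by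
  simp only [symCapacity_eq, Finset.sum_sub_distrib, ← Finset.sum_div, sum_condEnt_sub g hg W]
  simp only [Finset.sum_const, Finset.card_univ, Fintype.card_fin, nsmul_eq_mul]
  ring

end SubChannel

end DMC

/-! ### The entropy lost at one step controls an `L¹` distance -/

namespace DMC

section Divergence

variable {X : Type u} [Fintype X]

/-- The `L¹` distance between the output distributions of two inputs, up to the factor `q`. -/
noncomputable def inputDist (W : DMC X) (x x' : X) : ℝ := ∑' z, |W.joint z x - W.joint z x'|

/-- The probability that two independent samples from the posterior of the input given the output
are `a` and `b`. -/
noncomputable def postOverlap (W : DMC X) (a b : X) : ℝ :=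
  ∑' z, W.outProb z * (W.post z a * W.post z b)

theorem inputDist_hasSum (W : DMC X) (x x' : X) :
    HasSum (fun z => |W.joint z x - W.joint z x'|) (W.inputDist x x') :=
  ((W.joint_hasSum x).summable.sub (W.joint_hasSum x').summable).abs.hasSum

theorem inputDist_nonneg (W : DMC X) (x x' : X) : 0 ≤ W.inputDist x x' :=
  tsum_nonneg fun _ => abs_nonneg _

theorem postOverlap_hasSum [Nonempty X] (W : DMC X) (a b : X) :
    HasSum (fun z => W.outProb z * (W.post z a * W.post z b)) (W.postOverlap a b) := by
  refine (Summable.of_nonneg_of_le (fun z => ?_) (fun z => ?_) W.outProb_hasSum.summable).hasSum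
  · exact mul_nonneg (W.outProb_nonneg z) (mul_nonneg (W.post_nonneg z a) (W.post_nonneg z b))
  · exact mul_le_of_le_one_right (W.outProb_nonneg z)
      (mul_le_one₀ (W.post_le_one z a) (W.post_nonneg z b) (W.post_le_one z b))

theorem postOverlap_nonneg (W : DMC X) (a b : X) : 0 ≤ W.postOverlap a b :=
  tsum_nonneg fun z => mul_nonneg (W.outProb_nonneg z)
    (mul_nonneg (W.post_nonneg z a) (W.post_nonneg z b))

/-- The expectation over the outputs of a weight at position `k` times a test function at
position `j`. -/
theorem hasSum_powJoint_mul_mul {ℓ : ℕ} (W : DMC X) {j k : Fin ℓ} (hjk : j ≠ k) (x : Fin ℓ → X)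
    (r σ : W.Out → ℝ) {K E : ℝ} (hK : HasSum (fun z => W.joint z (x k) * r z) K)
    (hE : HasSum (fun z => W.joint z (x j) * σ z) E) :
    HasSum (fun y : Fin ℓ → W.Out => W.powJoint y x * r (y k) * σ (y j))
      ((∏ i, if i = k ∨ i = j then 1 else 1 / (Fintype.card X : ℝ)) * K * E) := by
  have h := hasSum_pi_prod_fin
    (fun (i : Fin ℓ) (z : W.Out) =>
      W.joint z (x i) * (if i = k then r z else 1) * (if i = j then σ z else 1))
    (fun i => (if i = k ∨ i = j then 1 else 1 / (Fintype.card X : ℝ)) *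
      (if i = k then K else 1) * (if i = j then E else 1)) fun i => by
      by_cases hi : i = k
      · subst hi; simpa [hjk.symm] using hK
      · by_cases hi' : i = j
        · subst hi'; simpa [hjk] using hE
        · simpa [hi, hi'] using W.joint_hasSum (x i)
  have h1 : ∀ (f : Fin ℓ → ℝ) (r σ : Fin ℓ → ℝ),
      ∏ i, f i * (if i = k then r i else 1) * (if i = j then σ i else 1) =
        (∏ i, f i) * r k * σ j := by
    intro f r σ
    rw [Finset.prod_mul_distrib, Finset.prod_mul_distrib, Finset.prod_ite_eq',
      Finset.prod_ite_eq']
    simp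
  rw [h1 _ (fun _ => K) fun _ => E] at h
  refine h.congr_fun fun y => ?_
  rw [h1 (fun i => W.joint (y i) (x i)) (fun i => r (y i)) fun i => σ (y i), powJoint]

variable [DecidableEq X] {ℓ : ℕ} {g : (Fin ℓ → X) → (Fin ℓ → X)} {k : Fin ℓ} {τ : X → X}

theorem sub_joint_eq_zero (hk : ∀ v, g v k = τ (v k)) (W : DMC X) {y : Fin ℓ → W.Out}
    (p : {j : Fin ℓ // j < k} → X) {a : X} (h : W.joint (y k) (τ a) = 0) :
    (sub g W k).joint (y, p) a = 0 := by
  rw [sub_joint]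
  refine Finset.sum_eq_zero fun u hu => Finset.prod_eq_zero (Finset.mem_univ k) ?_
  rw [hk, (Finset.mem_filter.1 hu).2.2, h]

/-- If the `k`-th channel input depends on `u_k` alone, then the loss of conditional entropy in
passing to the `k`-th subchannel is the divergence between the posterior of `u_k` given the full
output and its posterior given `y_k` only. -/
theorem condEnt_sub_sub_hasSum [Nonempty X] (hg : Function.Bijective g)
    (hk : ∀ v, g v k = τ (v k)) (W : DMC X) :
    HasSum (fun y : Fin ℓ → W.Out => ∑ p, ∑ a, (sub g W k).joint (y, p) a *
      (Real.log ((sub g W k).joint (y, p) a) -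
        Real.log ((sub g W k).outProb (y, p) * W.post (y k) (τ a))))
      (W.condEnt - (sub g W k).condEnt) := by
  have h := (W.hasSum_powJoint_mul k _ W.condEnt_hasSum').sub (sub_condEnt_hasSum g W k)
  refine h.congr_fun fun y => ?_
  rw [← hg.sum_comp, ← sum_prefix_fiberwise _ k, ← Finset.sum_sub_distrib]
  refine Finset.sum_congr rfl fun p _ => ?_
  change _ = _ - ∑ a, (sub g W k).joint (y, p) a *
    (Real.log ((sub g W k).outProb (y, p)) - Real.log ((sub g W k).joint (y, p) a))
  rw [← Finset.sum_sub_distrib]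
  refine Finset.sum_congr rfl fun a _ => ?_
  have h1 : ∑ u : Fin ℓ → X with (∀ j : {j : Fin ℓ // j < k}, u j = p j) ∧ u k = a,
      W.powJoint y (g u) *
        (Real.log (W.outProb (y k)) - Real.log (W.joint (y k) (g u k))) =
      (sub g W k).joint (y, p) a *
        (Real.log (W.outProb (y k)) - Real.log (W.joint (y k) (τ a))) := by
    rw [sub_joint, Finset.sum_mul]
    refine Finset.sum_congr rfl fun u hu => ?_
    rw [hk, (Finset.mem_filter.1 hu).2.2]
  rw [h1]
  by_cases hf : (sub g W k).joint (y, p) a = 0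
  · simp [hf]
  have hj : W.joint (y k) (τ a) ≠ 0 := fun h => hf (sub_joint_eq_zero hk W p h)
  have ho : W.outProb (y k) ≠ 0 := fun h => hj (W.joint_eq_zero_of_outProb h _)
  have hs : (sub g W k).outProb (y, p) ≠ 0 := fun h => hf (joint_eq_zero_of_outProb _ h _)
  rw [post, Real.log_mul hs (div_ne_zero hj ho), Real.log_div hj ho]
  ring

/-- The `L¹` distance between the two posteriors, weighted by the probability of the output, in
terms of their divergence. -/
theorem sum_abs_le_divergence (hτ : Function.Injective τ)
    (hk : ∀ v, g v k = τ (v k)) (W : DMC X) {θ : ℝ} (hθ : 0 < θ) (y : Fin ℓ → W.Out)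
    (p : {j : Fin ℓ // j < k} → X) :
    ∑ a, |(sub g W k).joint (y, p) a - (sub g W k).outProb (y, p) * W.post (y k) (τ a)| ≤
      (∑ a, (sub g W k).joint (y, p) a * (Real.log ((sub g W k).joint (y, p) a) -
        Real.log ((sub g W k).outProb (y, p) * W.post (y k) (τ a))) +
        4 * θ ^ 2 * (sub g W k).outProb (y, p)) / (2 * θ) := by
  set V := sub g W k
  set s := V.outProb (y, p) with hs
  have hs0 : 0 ≤ s := V.outProb_nonneg _
  have hm0 : ∀ a, 0 ≤ s * W.post (y k) (τ a) := fun a => mul_nonneg hs0 (W.post_nonneg _ _)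
  have hz : ∀ a, s * W.post (y k) (τ a) = 0 → V.joint (y, p) a = 0 := by
    intro a h
    rcases mul_eq_zero.1 h with h | h
    · exact V.joint_eq_zero_of_outProb h a
    · refine sub_joint_eq_zero hk W p ?_
      rw [← W.outProb_mul_post, h, mul_zero]
  have hm : ∑ a, s * W.post (y k) (τ a) ≤ s := by
    rw [← Finset.mul_sum]
    refine mul_le_of_le_one_right hs0 (le_trans (le_of_eq ?_) (W.sum_post_le_one (y k)))
    exact (Finite.injective_iff_bijective.1 hτ).sum_comp fun x => W.post (y k) x
  have h := Finset.sum_le_sum fun a (_ : a ∈ Finset.univ) =>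
    mul_log_sub_log_ge (θ := θ) (V.joint_nonneg (y, p) a) (hm0 a) (hz a)
  have hsum : ∑ a, V.joint (y, p) a = s := rfl
  simp only [Finset.sum_add_distrib, Finset.sum_sub_distrib, ← Finset.mul_sum, hsum] at h
  simp only [Finset.mul_sum] at h
  rw [le_div_iff₀ (by positivity)]
  simp only [← Finset.mul_sum] at h hm ⊢
  nlinarith [mul_le_mul_of_nonneg_left hm (sq_nonneg θ)]

/-- If `f` is close to a multiple of the posterior, then it is nearly proportional to it. The
cross differences on the left do not involve the normalisation `s`. -/
theorem abs_cross_le (W : DMC X) {a b : X} (hab : a ≠ b) (z : W.Out) (f : X → ℝ)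
    (s : ℝ) :
    |f a * W.post z (τ b) - f b * W.post z (τ a)| ≤ ∑ c, |f c - s * W.post z (τ c)| := by
  have h1 : f a * W.post z (τ b) - f b * W.post z (τ a) =
      (f a - s * W.post z (τ a)) * W.post z (τ b) -
        (f b - s * W.post z (τ b)) * W.post z (τ a) := by ring
  have h2 : ∀ c d, |(f c - s * W.post z (τ c)) * W.post z d| ≤ |f c - s * W.post z (τ c)| := by
    intro c d
    rw [abs_mul, abs_of_nonneg (W.post_nonneg z d)]
    exact mul_le_of_le_one_right (abs_nonneg _) (W.post_le_one z d)
  rw [h1]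
  refine (abs_sub _ _).trans ((add_le_add (h2 _ _) (h2 _ _)).trans ?_)
  rw [← Finset.sum_pair (f := fun c => |f c - s * W.post z (τ c)|) hab]
  exact Finset.sum_le_sum_of_subset_of_nonneg (Finset.subset_univ _) fun _ _ _ => abs_nonneg _

theorem card_prefix (p : {j : Fin ℓ // j < k} → X) (a : X) :
    (Finset.univ.filter fun u : Fin ℓ → X =>
      (∀ j : {j : Fin ℓ // j < k}, u j = p j) ∧ u k = a).card =
      ∏ i : Fin ℓ, if i ≤ k then 1 else Fintype.card X := by
  have h : (Finset.univ.filter fun u : Fin ℓ → X =>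
      (∀ j : {j : Fin ℓ // j < k}, u j = p j) ∧ u k = a) =
      Fintype.piFinset fun i => if h : i < k then {p ⟨i, h⟩} else
        if i = k then {a} else Finset.univ := by
    ext u
    simp only [Finset.mem_filter, Finset.mem_univ, true_and, Fintype.mem_piFinset]
    constructor
    · rintro ⟨h1, h2⟩ i
      by_cases hi : i < k
      · simpa [hi] using h1 ⟨i, hi⟩
      · by_cases hi' : i = k
        · subst hi'; simp [h2]
        · simp [hi, hi']
    · intro h
      refine ⟨fun j => ?_, ?_⟩
      · simpa [j.2] using h j
      · simpa using h k
  rw [h, Fintype.card_piFinset]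
  refine Finset.prod_congr rfl fun i _ => ?_
  rcases lt_trichotomy i k with hi | hi | hi
  · simp [hi, hi.le]
  · simp [hi]
  · simp [hi.not_gt, hi.ne', hi.not_ge]

theorem hasSum_sub_joint_mul [Nonempty X] (hk : ∀ v, g v k = τ (v k)) (W : DMC X) {j : Fin ℓ}
    (hjk : j ≠ k) (p : {j : Fin ℓ // j < k} → X) (a b : X) (c : X)
    (hc : ∀ u, (∀ i : {i : Fin ℓ // i < k}, u i = p i) → u k = a → g u j = c)
    (σ : W.Out → ℝ) {E : ℝ} (hE : HasSum (fun z => W.joint z c * σ z) E) :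
    HasSum (fun y : Fin ℓ → W.Out =>
      (sub g W k).joint (y, p) a * W.post (y k) (τ b) * σ (y j))
      ((∏ i : Fin ℓ, if i ≤ k then 1 else Fintype.card X : ℕ) *
        ((∏ i, if i = k ∨ i = j then 1 else 1 / (Fintype.card X : ℝ)) *
          W.postOverlap (τ a) (τ b) * E)) := by
  rw [← card_prefix p a, ← nsmul_eq_mul, ← Finset.sum_const]
  simp_rw [sub_joint, Finset.sum_mul]
  refine hasSum_sum fun u hu => ?_
  obtain ⟨h1, h2⟩ := (Finset.mem_filter.1 hu).2
  refine hasSum_powJoint_mul_mul W hjk (g u) (fun z => W.post z (τ b)) σ ?_ ?_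
  · refine (W.postOverlap_hasSum (τ a) (τ b)).congr_fun fun z => ?_
    rw [hk, h2, ← W.outProb_mul_post, mul_assoc]
  · rwa [hc u h1 h2]

/-- A lower bound on the loss of conditional entropy in the `k`-th subchannel. Here `χ p a` is the
input of the channel at position `j` when the past inputs are `p` and `u_k = a`. -/
theorem overlap_mul_inputDist_le [Nonempty X] (hg : Function.Bijective g)
    (hτ : Function.Injective τ) (hk : ∀ v, g v k = τ (v k)) (W : DMC X) {j : Fin ℓ} (hjk : j ≠ k)
    (χ : ({j : Fin ℓ // j < k} → X) → X → X)
    (hχ : ∀ p a u, (∀ i : {i : Fin ℓ // i < k}, u i = p i) → u k = a → g u j = χ p a)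
    {a b : X} (hab : a ≠ b) {θ : ℝ} (hθ : 0 < θ) :
    (∏ i : Fin ℓ, if i ≤ k then 1 else Fintype.card X : ℕ) *
        (∏ i, if i = k ∨ i = j then 1 else 1 / (Fintype.card X : ℝ)) *
      W.postOverlap (τ a) (τ b) * ∑ p, W.inputDist (χ p a) (χ p b) ≤
      (W.condEnt - (sub g W k).condEnt + 4 * θ ^ 2) / (2 * θ) := by
  set N : ℝ := ((∏ i : Fin ℓ, if i ≤ k then 1 else Fintype.card X : ℕ) : ℝ)
  set C : ℝ := ∏ i, if i = k ∨ i = j then 1 else 1 / (Fintype.card X : ℝ)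
  -- The distance is the value of the signed measure on the sign of its density.
  let σ : ({j : Fin ℓ // j < k} → X) → W.Out → ℝ := fun p z =>
    SignType.sign (W.joint z (χ p a) - W.joint z (χ p b))
  have hσ : ∀ p z, |σ p z| ≤ 1 := by
    intro p z
    rcases lt_trichotomy (W.joint z (χ p a) - W.joint z (χ p b)) 0 with h | h | h <;>
      simp [σ, h]
  have hs : ∀ p x, Summable fun z => W.joint z x * σ p z := fun p x =>
    Summable.of_norm_bounded (W.joint_hasSum x).summable fun z => by
      rw [norm_mul, Real.norm_of_nonneg (W.joint_nonneg z x)]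
      exact mul_le_of_le_one_right (W.joint_nonneg z x) (hσ p z)
  have h1 : ∀ p, HasSum (fun y : Fin ℓ → W.Out =>
      ((sub g W k).joint (y, p) a * W.post (y k) (τ b) -
        (sub g W k).joint (y, p) b * W.post (y k) (τ a)) * σ p (y j))
      (N * C * W.postOverlap (τ a) (τ b) * W.inputDist (χ p a) (χ p b)) := by
    intro p
    have ha := hasSum_sub_joint_mul hk W hjk p a b _ (hχ p a) (σ p) (hs p _).hasSum
    have hb := hasSum_sub_joint_mul hk W hjk p b a _ (hχ p b) (σ p) (hs p _).hasSum
    have hd : W.inputDist (χ p a) (χ p b) =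
        ∑' z, W.joint z (χ p a) * σ p z - ∑' z, W.joint z (χ p b) * σ p z := by
      rw [← (hs p _).tsum_sub (hs p _)]
      refine tsum_congr fun z => ?_
      rw [← sub_mul, self_mul_sign]
    have hc : W.postOverlap (τ b) (τ a) = W.postOverlap (τ a) (τ b) := by
      simp only [postOverlap, mul_comm (W.post _ (τ b))]
    rw [hc] at hb
    have := ha.sub hb
    simp only [← sub_mul, ← mul_sub] at this
    rw [hd]
    simpa only [mul_assoc] using this
  have h2 := hasSum_sum (s := Finset.univ) fun p (_ : p ∈ Finset.univ) => h1 p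
  have h3 : HasSum (fun y : Fin ℓ → W.Out => ∑ p, (sub g W k).outProb (y, p)) 1 :=
    (sub g W k).outProb_hasSum.prod_fiberwise fun _ => hasSum_fintype _
  have h4 := ((condEnt_sub_sub_hasSum hg hk W).add (h3.mul_left (4 * θ ^ 2))).div_const (2 * θ)
  rw [mul_one] at h4
  rw [Finset.mul_sum]
  refine hasSum_le (fun y => ?_) h2 h4
  rw [Finset.mul_sum, ← Finset.sum_add_distrib, Finset.sum_div]
  refine Finset.sum_le_sum fun p _ => ?_
  refine le_trans ?_ (sum_abs_le_divergence hτ hk W hθ y p)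
  refine le_trans ?_ (abs_cross_le (τ := τ) W hab (y k) _ _)
  refine (le_abs_self _).trans ?_
  rw [abs_mul]
  exact mul_le_of_le_one_right (abs_nonneg _) (hσ p _)

end Divergence

section Linear

variable {X : Type u} [Field X] [Fintype X]

/-- The average effect on the output distribution of shifting the input by `d`. -/
noncomputable def shiftDist (W : DMC X) (d : X) : ℝ := ∑ c, W.inputDist (c + d) c

theorem shiftDist_nonneg (W : DMC X) (d : X) : 0 ≤ W.shiftDist d :=
  Finset.sum_nonneg fun _ _ => W.inputDist_nonneg _ _

variable [DecidableEq X] {ℓ : ℕ}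

/-- Only pasts `p` supported at position `j` are used: they already make the contribution of the
past to the input at position `j` range over the whole field. -/
theorem exists_overlap_mul_shiftDist_le (G : Matrix (Fin ℓ) (Fin ℓ) X)
    (hg : Function.Bijective (linearKernel G)) (hlower : ∀ i j : Fin ℓ, i < j → G i j = 0)
    (hne : ∀ i, G i i ≠ 0) {k : Fin ℓ} (hk : ∀ i, k < i → ∀ j, j ≠ i → G i j = 0)
    {j : Fin ℓ} (hjk : j < k) :
    ∃ C : ℝ, 0 < C ∧ ∀ (W : DMC X) (a b : X) (θ : ℝ), a ≠ b → 0 < θ →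
      C * W.postOverlap a b * W.shiftDist (G k j / G k k * (a - b)) ≤
        (W.condEnt - (sub (linearKernel G) W k).condEnt + 4 * θ ^ 2) / (2 * θ) := by
  have hq : 0 < (Fintype.card X : ℝ) := by exact_mod_cast Fintype.card_pos
  refine ⟨(∏ i : Fin ℓ, if i ≤ k then 1 else Fintype.card X : ℕ) *
        (∏ i, if i = k ∨ i = j then 1 else 1 / (Fintype.card X : ℝ)), ?_, ?_⟩
  · refine mul_pos (Nat.cast_pos.2 (Finset.prod_pos fun i _ => ?_))
      (Finset.prod_pos fun i _ => ?_)
    · split_ifs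
      · exact one_pos
      · exact Fintype.card_pos
    · split_ifs <;> positivity
  intro W a b θ hab hθ
  have hkk : ∀ v, linearKernel G v k = v k * G k k := by
    intro v
    rw [linearKernel, Matrix.vecMul, dotProduct]
    refine Finset.sum_eq_single k (fun i _ hi => ?_) (by simp)
    rcases lt_or_gt_of_ne hi with h | h
    · rw [hlower i k h, mul_zero]
    · rw [hk i h k h.ne, mul_zero]
  let χ : ({i : Fin ℓ // i < k} → X) → X → X := fun p a =>
    ∑ i : Fin ℓ, (if h : i < k then p ⟨i, h⟩ else 0) * G i j + a * G k j
  have hχ : ∀ p a u, (∀ i : {i : Fin ℓ // i < k}, u i = p i) → u k = a →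
      linearKernel G u j = χ p a := by
    intro p a u h1 h2
    have h3 : a * G k j = ∑ i : Fin ℓ, if i = k then u i * G i j else 0 := by simp [h2]
    rw [linearKernel, Matrix.vecMul, dotProduct]
    simp only [χ, h3]
    rw [← Finset.sum_add_distrib]
    refine Finset.sum_congr rfl fun i _ => ?_
    rcases lt_trichotomy i k with h | h | h
    · simp [h, h.ne, h1 ⟨i, h⟩]
    · simp [h]
    · simp [h.not_gt, h.ne', hk i h j (hjk.trans h).ne]
  have hτ : Function.Injective fun x : X => x * G k k := mul_left_injective₀ (hne k)
  have h := overlap_mul_inputDist_le hg hτ hkk W hjk.ne χ hχ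
    (a := a / G k k) (b := b / G k k) (fun h => hab ((div_left_inj' (hne k)).1 h)) hθ
  simp only [div_mul_cancel₀ _ (hne k)] at h
  refine le_trans ?_ h
  have hC : ∀ i : Fin ℓ, (0 : ℝ) ≤ if i = k ∨ i = j then 1 else 1 / (Fintype.card X : ℝ) := by
    intro i
    split_ifs <;> positivity
  refine mul_le_mul_of_nonneg_left ?_ (mul_nonneg (mul_nonneg (Nat.cast_nonneg _)
    (Finset.prod_nonneg fun i _ => hC i)) (W.postOverlap_nonneg a b))
  -- The past input vector with the single possibly nonzero entry `t` at position `j`.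
  let P : X → ({i : Fin ℓ // i < k} → X) := fun t i => if i.1 = j then t else 0
  have hP : Function.Injective P := by
    intro t t' h
    simpa [P] using congrFun h ⟨j, hjk⟩
  have hχP : ∀ t x, χ (P t) x = t * G j j + x * G k j := by
    intro t x
    simp only [χ, P]
    rw [Finset.sum_eq_single j]
    · simp [hjk]
    · intro i _ hi
      simp [hi]
    · simp
  have hbij : Function.Bijective fun t : X => t * G j j + b / G k k * G k j :=
    Finite.injective_iff_bijective.1 fun t t' h => mul_left_injective₀ (hne j) (add_left_injective _ h)
  calc W.shiftDist (G k j / G k k * (a - b))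
      = ∑ t, W.inputDist (χ (P t) (a / G k k)) (χ (P t) (b / G k k)) := by
        rw [shiftDist, ← hbij.sum_comp]
        refine Finset.sum_congr rfl fun t _ => ?_
        rw [hχP, hχP]
        congr 1
        have := hne k
        field_simp
        ring
    _ = ∑ p ∈ Finset.univ.image P, W.inputDist (χ p (a / G k k)) (χ p (b / G k k)) :=
        (Finset.sum_image (f := fun p => W.inputDist (χ p (a / G k k)) (χ p (b / G k k)))
          fun _ _ _ _ h => hP h).symm
    _ ≤ ∑ p, W.inputDist (χ p (a / G k k)) (χ p (b / G k k)) :=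
        Finset.sum_le_sum_of_subset_of_nonneg (Finset.subset_univ _)
          fun _ _ _ => W.inputDist_nonneg _ _

end Linear

end DMC

/-! ### Channels that are nearly unchanged are nearly useless or nearly perfect -/

namespace DMC

/-- Bounds the entropy contribution of a probability `r` by its variance `r (1 - r)`. -/
theorem neg_mul_log_le {r θ : ℝ} (h0 : 0 ≤ r) (h1 : r ≤ 1) (hθ : 0 < θ) :
    r * -Real.log r ≤ r * (1 - r) / θ + θ := by
  obtain ⟨u, hu, rfl⟩ : ∃ u, 0 ≤ u ∧ r = u ^ 2 := ⟨√r, Real.sqrt_nonneg r, (Real.sq_sqrt h0).symm⟩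
  rcases eq_or_lt_of_le hu with rfl | hu'
  · simpa using hθ.le
  have hu1 : u ≤ 1 := by nlinarith
  have h2 := Real.log_le_sub_one_of_pos (inv_pos.2 hu')
  rw [Real.log_inv] at h2
  have h3 : u ^ 2 * -Real.log (u ^ 2) ≤ 2 * u * (1 - u) := by
    rw [Real.log_pow]
    have h4 := mul_le_mul_of_nonneg_left h2 (sq_nonneg u)
    have h5 : u ^ 2 * (u⁻¹ - 1) = u * (1 - u) := by field_simp
    push_cast
    nlinarith
  have h6 : 2 * u * (1 - u) ≤ 2 * u * (1 - u ^ 2) := by nlinarith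
  have h7 : 2 * u ≤ u ^ 2 / θ + θ := by
    have : u ^ 2 / θ + θ - 2 * u = (u - θ) ^ 2 / θ := by field_simp; ring
    have : 0 ≤ (u - θ) ^ 2 / θ := by positivity
    linarith
  have h8 := mul_le_mul_of_nonneg_right h7 (by nlinarith : (0 : ℝ) ≤ 1 - u ^ 2)
  have h9 : u ^ 2 * (1 - u ^ 2) / θ = u ^ 2 / θ * (1 - u ^ 2) := by ring
  rw [h9]
  nlinarith [mul_nonneg hθ.le (sq_nonneg u)]

section Dichotomy

variable {X : Type u} [Field X] [Fintype X]

/-- The probability that two independent samples from the posterior of the input given the output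
differ by `d`. -/
noncomputable def shiftOverlap (W : DMC X) (d : X) : ℝ := ∑ c, W.postOverlap (c + d) c

theorem shiftOverlap_nonneg (W : DMC X) (d : X) : 0 ≤ W.shiftOverlap d :=
  Finset.sum_nonneg fun _ _ => W.postOverlap_nonneg _ _

theorem shiftOverlap_hasSum (W : DMC X) (d : X) :
    HasSum (fun z => ∑ c, W.outProb z * (W.post z (c + d) * W.post z c)) (W.shiftOverlap d) :=
  hasSum_sum fun _ _ => W.postOverlap_hasSum _ _

theorem shiftDist_hasSum (W : DMC X) (d : X) :
    HasSum (fun z => ∑ c, |W.joint z (c + d) - W.joint z c|) (W.shiftDist d) :=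
  hasSum_sum fun _ _ => W.inputDist_hasSum _ _

theorem shiftDist_zero (W : DMC X) : W.shiftDist 0 = 0 := by
  simp [shiftDist, inputDist]

/-- A posterior that is nearly invariant under a shift puts substantial mass on pairs of inputs
that differ by this shift. -/
theorem inv_card_le_shiftOverlap_add_shiftDist (W : DMC X) (d : X) :
    1 / (Fintype.card X : ℝ) ≤ W.shiftOverlap d + W.shiftDist d := by
  have hq : 0 < (Fintype.card X : ℝ) := by exact_mod_cast Fintype.card_pos
  refine hasSum_le (fun z => ?_) (W.outProb_hasSum.div_const (Fintype.card X : ℝ))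
    ((W.shiftOverlap_hasSum d).add (W.shiftDist_hasSum d))
  have h1 : W.outProb z / Fintype.card X ≤ ∑ c, W.joint z c * W.post z c := by
    have h2 := sq_sum_le_card_mul_sum_sq (s := Finset.univ) (f := fun c => W.post z c)
    have h3 := mul_le_mul_of_nonneg_left h2 (W.outProb_nonneg z)
    rw [sq, ← mul_assoc, outProb_mul_sum_post, outProb_mul_sum_post, Finset.card_univ] at h3
    rw [div_le_iff₀ hq]
    refine h3.trans (le_of_eq ?_)
    rw [mul_left_comm, mul_comm, Finset.mul_sum]
    congr 1
    refine Finset.sum_congr rfl fun c _ => ?_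
    rw [← outProb_mul_post]; ring
  refine h1.trans ?_
  rw [← Finset.sum_add_distrib]
  refine Finset.sum_le_sum fun c _ => ?_
  rw [← mul_assoc, outProb_mul_post]
  have h4 : W.joint z c * W.post z c - W.joint z (c + d) * W.post z c ≤
      |W.joint z (c + d) - W.joint z c| := by
    rw [← sub_mul, abs_sub_comm]
    exact (mul_le_mul_of_nonneg_right (le_abs_self _) (W.post_nonneg z c)).trans
      (mul_le_of_le_one_right (abs_nonneg _) (W.post_le_one z c))
  linarith

/-- If the joint distribution is nearly invariant under shifts of the input, then the conditional
entropy is nearly maximal. -/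
theorem log_card_sub_condEnt_le (W : DMC X) :
    Real.log (Fintype.card X) - W.condEnt ≤ ∑ d, W.shiftDist d := by
  have hq : 0 < (Fintype.card X : ℝ) := by exact_mod_cast Fintype.card_pos
  refine hasSum_le (fun z => ?_) W.log_card_sub_condEnt_hasSum
    (hasSum_sum fun d (_ : d ∈ Finset.univ) => W.shiftDist_hasSum d)
  rw [Finset.sum_comm]
  refine Finset.sum_le_sum fun x _ => ?_
  rcases eq_or_lt_of_le (W.joint_nonneg z x) with hf | hf
  · rw [← hf, zero_mul]
    exact Finset.sum_nonneg fun _ _ => abs_nonneg _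
  have ho : 0 < W.outProb z := hf.trans_le (W.joint_le_outProb z x)
  have h1 : Real.log (W.joint z x) - Real.log (W.outProb z / Fintype.card X) ≤
      W.joint z x / (W.outProb z / Fintype.card X) - 1 := by
    rw [← Real.log_div hf.ne' (by positivity)]
    exact Real.log_le_sub_one_of_pos (by positivity)
  have h2 : W.joint z x * (W.joint z x / (W.outProb z / Fintype.card X) - 1) =
      W.post z x * ∑ d, (W.joint z x - W.joint z (x + d)) := by
    have h3 : ∑ d, W.joint z (x + d) = W.outProb z := Equiv.sum_comp (Equiv.addLeft x) (W.joint z)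
    rw [Finset.sum_sub_distrib, h3, post]
    simp only [Finset.sum_const, Finset.card_univ, nsmul_eq_mul]
    field_simp
  refine (mul_le_mul_of_nonneg_left h1 hf.le).trans ?_
  rw [h2, Finset.mul_sum]
  refine Finset.sum_le_sum fun d _ => ?_
  rw [abs_sub_comm]
  exact (mul_le_mul_of_nonneg_left (le_abs_self _) (W.post_nonneg z x)).trans
    (mul_le_of_le_one_left (abs_nonneg _) (W.post_le_one z x))

variable [DecidableEq X]

/-- If two independent samples from the posterior rarely differ, then the conditional entropy is
small. -/
theorem condEnt_le (W : DMC X) {θ : ℝ} (hθ : 0 < θ) :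
    W.condEnt ≤ (∑ d ∈ Finset.univ.erase 0, W.shiftOverlap d) / θ + Fintype.card X * θ := by
  have hR := (W.outProb_hasSum.mul_left (Fintype.card X * θ))
  rw [mul_one] at hR
  refine hasSum_le (fun z => ?_) W.condEnt_hasSum
    (((hasSum_sum fun d (_ : d ∈ Finset.univ.erase (0 : X)) =>
      W.shiftOverlap_hasSum d).div_const θ).add hR)
  rw [Finset.sum_comm, Finset.sum_div, ent_joint]
  have h0 : (Fintype.card X : ℝ) * θ * W.outProb z = ∑ _x : X, θ * W.outProb z := by
    simp [mul_assoc]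
  rw [h0, ← Finset.sum_add_distrib]
  refine Finset.sum_le_sum fun x _ => ?_
  by_cases ho : W.outProb z = 0
  · simp [ho, W.joint_eq_zero_of_outProb ho]
  have h1 : ∑ d ∈ Finset.univ.erase 0, W.post z (x + d) = 1 - W.post z x := by
    have h2 : ∑ d, W.post z (x + d) = 1 := by
      refine (Equiv.sum_comp (Equiv.addLeft x) (W.post z)).trans ?_
      exact mul_left_cancel₀ ho ((W.outProb_mul_sum_post z).trans (mul_one _).symm)
    rw [← Finset.add_sum_erase _ _ (Finset.mem_univ (0 : X)), add_zero] at h2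
    linarith
  have h3 : W.joint z x * (Real.log (W.outProb z) - Real.log (W.joint z x)) =
      W.outProb z * (W.post z x * -Real.log (W.post z x)) := by
    by_cases hj : W.joint z x = 0
    · simp [hj, post]
    · rw [← mul_assoc, outProb_mul_post, post, Real.log_div hj ho]; ring
  have h4 : ∑ d ∈ Finset.univ.erase 0, W.outProb z * (W.post z (x + d) * W.post z x) =
      W.outProb z * (W.post z x * (1 - W.post z x)) := by
    rw [← Finset.mul_sum, ← Finset.sum_mul, h1, mul_comm (W.post z x)]
  rw [h3, h4]
  refine (mul_le_mul_of_nonneg_left (neg_mul_log_le (W.post_nonneg z x) (W.post_le_one z x) hθ)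
    (W.outProb_nonneg z)).trans (le_of_eq ?_)
  ring

/-- Multiplication by the primitive element `γ` carries smallness of `T` from one nonzero shift to
all of them. -/
theorem forall_le_or_forall_le {γ : X} (hγ : IsPrimitiveElement γ) {S T : X → ℝ} {q η : ℝ}
    (hq : 0 < q) (hηq : η ≤ 1 / (2 * q))
    (hST : ∀ d, 1 / q ≤ S d + T d) (hS : ∀ d, 0 ≤ S d) (hT : ∀ d, 0 ≤ T d)
    (hmul : ∀ d, d ≠ 0 → S d * T (γ * d) ≤ η / (2 * q)) :
    (∀ d, d ≠ 0 → T d ≤ η) ∨ ∀ d, d ≠ 0 → S d ≤ η := by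
  by_cases h : ∃ d, d ≠ 0 ∧ T d ≤ 1 / (2 * q)
  · obtain ⟨d₀, hd₀, h₀⟩ := h
    left
    have step : ∀ d, d ≠ 0 → T d ≤ 1 / (2 * q) → T (γ * d) ≤ η := by
      intro d hd hTd
      have h1 : 1 / (2 * q) ≤ S d := by
        have h2 := hST d
        have h3 : 1 / q = 1 / (2 * q) + 1 / (2 * q) := by field_simp; norm_num
        linarith
      have h4 := (mul_le_mul_of_nonneg_right h1 (hT (γ * d))).trans (hmul d hd)
      rw [div_mul_eq_mul_div, one_mul] at h4
      exact (div_le_div_iff_of_pos_right (by positivity)).1 h4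
    have hpow : ∀ n : ℕ, T (γ ^ (n + 1) * d₀) ≤ η := by
      intro n
      induction n with
      | zero => simpa using step d₀ hd₀ h₀
      | succ n ih =>
        have := step _ (mul_ne_zero (pow_ne_zero (n + 1) hγ.1) hd₀) (ih.trans hηq)
        rwa [← mul_assoc, ← pow_succ'] at this
    intro d hd
    obtain ⟨n, hn⟩ := hγ.2 (d / (γ * d₀)) (div_ne_zero hd (mul_ne_zero hγ.1 hd₀))
    have h5 := hpow n
    have hγ0 := hγ.1
    rwa [pow_succ, hn, show d / (γ * d₀) * γ * d₀ = d by field_simp] at h5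
  · right
    push Not at h
    intro d hd
    have h1 := h (γ * d) (mul_ne_zero hγ.1 hd)
    have h2 := (mul_le_mul_of_nonneg_left h1.le (hS d)).trans (hmul d hd)
    rw [mul_one_div] at h2
    exact (div_le_div_iff_of_pos_right (by positivity)).1 h2

variable {ℓ : ℕ}

/-- If the `k`-th subchannel has almost the same symmetric capacity as the channel itself, then
this capacity is close to `0` or to `1`, uniformly over all channels. -/
theorem exists_symCapacity_le_or_ge (G : Matrix (Fin ℓ) (Fin ℓ) X)
    (hg : Function.Bijective (linearKernel G)) (hlower : ∀ i j : Fin ℓ, i < j → G i j = 0)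
    (hne : ∀ i, G i i ≠ 0) {k : Fin ℓ} (hk : ∀ i, k < i → ∀ j, j ≠ i → G i j = 0)
    {j : Fin ℓ} (hjk : j < k) (hprim : IsPrimitiveElement (G k j / G k k)) {ε : ℝ} (hε : 0 < ε) :
    ∃ δ : ℝ, 0 < δ ∧ ∀ W : DMC X,
      (sub (linearKernel G) W k).symCapacity - W.symCapacity ≤ δ →
        W.symCapacity ≤ ε ∨ 1 - ε ≤ W.symCapacity := by
  obtain ⟨C, hC, hmain⟩ := exists_overlap_mul_shiftDist_le G hg hlower hne hk hjk
  have hq : 0 < (Fintype.card X : ℝ) := by exact_mod_cast Fintype.card_pos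
  have hL : 0 < Real.log (Fintype.card X) :=
    Real.log_pos (by exact_mod_cast Fintype.one_lt_card)
  set q : ℝ := (Fintype.card X : ℝ) with hqdef
  set L := Real.log q with hLdef
  -- The bounds on `η` serve, in turn, the dichotomy, the case of capacity near `0`, and the case of
  -- capacity near `1`.
  obtain ⟨η, hη, hη1, hη2, hη3⟩ : ∃ η : ℝ, 0 < η ∧ η ≤ 1 / (2 * q) ∧ η ≤ ε * L / q ∧
      η ≤ (ε * L) ^ 2 / (4 * q ^ 2) :=
    ⟨min (1 / (2 * q)) (min (ε * L / q) ((ε * L) ^ 2 / (4 * q ^ 2))),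
      lt_min (by positivity) (lt_min (by positivity) (by positivity)), min_le_left _ _,
      (min_le_right _ _).trans (min_le_left _ _), (min_le_right _ _).trans (min_le_right _ _)⟩
  -- With this `θ` and `δ = θ² / L` the bound `(L δ + 4 θ²) / (2 θ)` equals `C η / (2 q²)`.
  set θ := C * η / (5 * q ^ 2) with hθdef
  have hθ : 0 < θ := by positivity
  refine ⟨θ ^ 2 / L, by positivity, fun W hW => ?_⟩
  have hH : W.condEnt - (sub (linearKernel G) W k).condEnt ≤ θ ^ 2 := by
    rw [symCapacity_eq, symCapacity_eq, ← hqdef, ← hLdef] at hW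
    have h : (W.condEnt - (sub (linearKernel G) W k).condEnt) / L ≤ θ ^ 2 / L := by
      rw [sub_div]; linarith
    exact (div_le_div_iff_of_pos_right hL).1 h
  have hmul : ∀ d, d ≠ 0 →
      W.shiftOverlap d * W.shiftDist (G k j / G k k * d) ≤ η / (2 * q) := by
    intro d hd
    have h1 : ∀ c, W.postOverlap (c + d) c * W.shiftDist (G k j / G k k * d) ≤
        η / (2 * q ^ 2) := by
      intro c
      have h2 := hmain W (c + d) c θ (by simpa using hd) hθ
      rw [add_sub_cancel_left, mul_assoc] at h2
      have h3 : (W.condEnt - (sub (linearKernel G) W k).condEnt + 4 * θ ^ 2) / (2 * θ) ≤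
          C * (η / (2 * q ^ 2)) := by
        rw [div_le_iff₀ (by positivity)]
        have h4 : C * (η / (2 * q ^ 2)) = 5 / 2 * θ := by rw [hθdef]; field_simp
        rw [h4]
        nlinarith
      exact le_of_mul_le_mul_left (h2.trans h3) hC
    rw [shiftOverlap, Finset.sum_mul]
    refine (Finset.sum_le_sum fun c _ => h1 c).trans (le_of_eq ?_)
    rw [Finset.sum_const, Finset.card_univ, nsmul_eq_mul, ← hqdef]
    field_simp
  have hcap : W.symCapacity * L = L - W.condEnt := by
    rw [symCapacity_eq, ← hqdef, ← hLdef]; field_simp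
  rcases forall_le_or_forall_le hprim hq hη1 W.inv_card_le_shiftOverlap_add_shiftDist
    W.shiftOverlap_nonneg W.shiftDist_nonneg hmul with hT | hS
  · left
    have h1 : ∑ d, W.shiftDist d ≤ q * η := by
      have : ∀ d ∈ Finset.univ, W.shiftDist d ≤ η := by
        intro d _
        by_cases hd : d = 0
        · rw [hd, shiftDist_zero]; exact hη.le
        · exact hT d hd
      simpa using Finset.sum_le_sum this
    have h2 := hcap.le.trans (W.log_card_sub_condEnt_le.trans h1)
    rw [le_div_iff₀ hq] at hη2
    exact le_of_mul_le_mul_right (by linarith) hL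
  · right
    have h1 : ∑ d ∈ Finset.univ.erase 0, W.shiftOverlap d ≤ q * η := by
      have := Finset.sum_le_sum fun d (hd : d ∈ Finset.univ.erase 0) =>
        hS d (Finset.ne_of_mem_erase hd)
      refine this.trans ?_
      rw [Finset.sum_const, nsmul_eq_mul]
      refine mul_le_mul_of_nonneg_right ?_ hη.le
      exact Nat.cast_le.2 (Finset.card_le_univ _)
    have h2 := W.condEnt_le (θ := ε * L / (2 * q)) (by positivity)
    have h3 : (∑ d ∈ Finset.univ.erase 0, W.shiftOverlap d) / (ε * L / (2 * q)) ≤ ε * L / 2 := by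
      rw [div_le_iff₀ (by positivity)]
      refine h1.trans ((mul_le_mul_of_nonneg_left hη3 hq.le).trans (le_of_eq ?_))
      field_simp
      norm_num
    have h4 : q * (ε * L / (2 * q)) = ε * L / 2 := by field_simp
    rw [← hqdef, h4] at h2
    exact le_of_mul_le_mul_right (by linarith) hL

end Dichotomy

end DMC

/-! ### The capacity martingale -/

namespace DMC

section Martingale

variable {X : Type u} [Fintype X] [DecidableEq X] {ℓ : ℕ} {Ω : Type*} [MeasurableSpace Ω]

/-- The history of the random indices before time `n`; in contrast to the natural filtration the
index at time `n` itself is excluded. -/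
def history (B : ℕ → Ω → Fin ℓ) (hB : ∀ n, Measurable (B n)) : Filtration ℕ ‹MeasurableSpace Ω› where
  seq n := ⨆ j ∈ {j | j < n}, MeasurableSpace.comap (B j) inferInstance
  mono' _ _ hmn := biSup_mono fun _ hj => lt_of_lt_of_le hj hmn
  le' _ := iSup₂_le fun j _ => (hB j).comap_le

theorem measurable_history (B : ℕ → Ω → Fin ℓ) (hB : ∀ n, Measurable (B n)) {m n : ℕ}
    (h : m < n) : Measurable[history B hB n] (B m) := by
  refine Measurable.mono (comap_measurable (B m)) ?_ le_rfl
  exact le_iSup₂_of_le (f := fun j (_ : j ∈ {j | j < n}) =>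
    MeasurableSpace.comap (B j) inferInstance) m h le_rfl

/-- The next channel as a combination of functions of the history with indicators of the new
index. -/
theorem iter_succ_eq_sum (g : (Fin ℓ → X) → (Fin ℓ → X)) (W : DMC X) (b : ℕ → Fin ℓ) (n : ℕ)
    (h : DMC X → ℝ) :
    h (iter g W b (n + 1)) = ∑ i, h (sub g (iter g W b n) i) * (if b n = i then 1 else 0) := by
  simp [iter]

theorem measurable_iter (g : (Fin ℓ → X) → (Fin ℓ → X)) (W : DMC X) (B : ℕ → Ω → Fin ℓ)
    (hB : ∀ n, Measurable (B n)) (n : ℕ) : ∀ h : DMC X → ℝ,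
    Measurable[history B hB n] fun ω => h (iter g W (fun t => B t ω) n) := by
  induction n with
  | zero => exact fun h => @measurable_const _ _ _ (_) (h W)
  | succ n ih =>
    intro h
    simp_rw [iter_succ_eq_sum]
    refine Finset.measurable_fun_sum _ fun i _ => Measurable.mul ?_ ?_
    · exact (ih fun V => h (sub g V i)).mono ((history B hB).mono n.le_succ) le_rfl
    · exact (measurable_of_finite (fun j : Fin ℓ => if j = i then (1 : ℝ) else 0)).comp
        (measurable_history B hB n.lt_succ_self)

variable (P : Measure Ω) [IsProbabilityMeasure P] {B : ℕ → Ω → Fin ℓ}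

theorem condExp_indicator_history (hB : ∀ n, Measurable (B n)) (hind : iIndepFun B P)
    (hunif : ∀ n i, P {ω | B n ω = i} = (ℓ : ENNReal)⁻¹) (n : ℕ) (i : Fin ℓ) :
    P[fun ω => if B n ω = i then (1 : ℝ) else 0 | history B hB n] =ᵐ[P] fun _ => (ℓ : ℝ)⁻¹ := by
  have h1 : Indep (MeasurableSpace.comap (B n) inferInstance) (history B hB n) P := by
    have := indep_iSup_of_disjoint (fun j => (hB j).comap_le) hind (S := {n}) (T := {j | j < n})
      (by simp)
    rwa [iSup_singleton] at this
  have h2 : StronglyMeasurable[MeasurableSpace.comap (B n) inferInstance]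
      fun ω => if B n ω = i then (1 : ℝ) else 0 :=
    ((measurable_of_finite (fun j : Fin ℓ => if j = i then (1 : ℝ) else 0)).comp
      (comap_measurable (B n))).stronglyMeasurable
  refine (condExp_indep_eq (hB n).comap_le ((history B hB).le n) h2 h1).trans ?_
  have h3 : ∫ ω, (if B n ω = i then (1 : ℝ) else 0) ∂P = (ℓ : ℝ)⁻¹ := by
    have h4 : (fun ω => if B n ω = i then (1 : ℝ) else 0) =
        Set.indicator {ω | B n ω = i} fun _ => 1 := by
      ext ω; simp [Set.indicator_apply]
    have h5 : MeasurableSet {ω | B n ω = i} := hB n (measurableSet_singleton i)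
    rw [h4, integral_indicator_const _ h5, measureReal_def, hunif]
    simp
  rw [h3]

theorem martingale_symCapacity [Nontrivial X] {g : (Fin ℓ → X) → (Fin ℓ → X)}
    (hg : Function.Bijective g) (W : DMC X) (hB : ∀ n, Measurable (B n)) (hind : iIndepFun B P)
    (hunif : ∀ n i, P {ω | B n ω = i} = (ℓ : ENNReal)⁻¹) :
    Martingale (fun n ω => (iter g W (fun t => B t ω) n).symCapacity) (history B hB) P := by
  have hmeas := fun n => measurable_iter g W B hB n
  have hle := (history B hB).le
  have hbdd : ∀ V : DMC X, ‖V.symCapacity‖ ≤ 1 := fun V => by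
    rw [Real.norm_of_nonneg V.symCapacity_nonneg]; exact V.symCapacity_le_one
  have hint : ∀ n (f : DMC X → DMC X),
      Integrable (fun ω => (f (iter g W (fun t => B t ω) n)).symCapacity) P := fun n f =>
    Integrable.of_bound (((hmeas n fun V => (f V).symCapacity).mono (hle n) le_rfl
      ).aestronglyMeasurable) 1 (ae_of_all _ fun ω => hbdd _)
  refine martingale_nat (fun n => (hmeas n _).stronglyMeasurable) (fun n => hint n id) fun n => ?_
  have hℓ : (ℓ : ℝ) ≠ 0 := by
    have : Nonempty Ω := nonempty_of_isProbabilityMeasure P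
    exact Nat.cast_ne_zero.2 (Fin.pos (B 0 (Classical.arbitrary Ω))).ne'
  have hind1 : ∀ i, Measurable fun ω => if B n ω = i then (1 : ℝ) else 0 := fun i =>
    (measurable_of_finite (fun j : Fin ℓ => if j = i then (1 : ℝ) else 0)).comp (hB n)
  have hind2 : ∀ i ω, ‖if B n ω = i then (1 : ℝ) else 0‖ ≤ 1 := fun i ω => by
    split_ifs <;> simp
  have hint1 : ∀ i, Integrable (fun ω => if B n ω = i then (1 : ℝ) else 0) P := fun i =>
    Integrable.of_bound (hind1 i).aestronglyMeasurable 1 (ae_of_all _ (hind2 i))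
  have hint2 : ∀ i, Integrable ((fun ω => (sub g (iter g W (fun t => B t ω) n) i).symCapacity) *
      fun ω => if B n ω = i then (1 : ℝ) else 0) P := fun i =>
    (hint n fun V => sub g V i).mul_bdd (c := 1) (hind1 i).aestronglyMeasurable
      (ae_of_all _ (hind2 i))
  have hsum : (fun ω => (iter g W (fun t => B t ω) (n + 1)).symCapacity) =
      ∑ i, (fun ω => (sub g (iter g W (fun t => B t ω) n) i).symCapacity) *
        fun ω => if B n ω = i then (1 : ℝ) else 0 := by
    ext ω
    rw [iter_succ_eq_sum g W _ n symCapacity]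
    simp
  rw [hsum]
  have hpull : ∀ i, P[(fun ω => (sub g (iter g W (fun t => B t ω) n) i).symCapacity) *
      (fun ω => if B n ω = i then (1 : ℝ) else 0) | history B hB n] =ᵐ[P]
      fun ω => (sub g (iter g W (fun t => B t ω) n) i).symCapacity * (ℓ : ℝ)⁻¹ := by
    intro i
    refine (condExp_mul_of_stronglyMeasurable_left
      (hmeas n fun V => (sub g V i).symCapacity).stronglyMeasurable (hint2 i) (hint1 i)).trans ?_
    filter_upwards [condExp_indicator_history P hB hind hunif n i] with ω hω
    rw [Pi.mul_apply, hω]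
  filter_upwards [condExp_finsetSum (s := Finset.univ) (fun i _ => hint2 i) (history B hB n),
    ae_all_iff.2 hpull] with ω h1 h2
  rw [h1, Finset.sum_apply, Finset.sum_congr rfl fun i _ => h2 i, ← Finset.sum_mul,
    sum_symCapacity_sub g hg]
  field_simp

theorem ae_frequently_eq (hB : ∀ n, Measurable (B n)) (hind : iIndepFun B P)
    (hunif : ∀ n i, P {ω | B n ω = i} = (ℓ : ENNReal)⁻¹) (k : Fin ℓ) :
    ∀ᵐ ω ∂P, ∃ᶠ n in atTop, B n ω = k := by
  have hm : ∀ n, MeasurableSet {ω | B n ω = k} := fun n => hB n (measurableSet_singleton k)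
  have h1 : iIndepSet (fun n => {ω | B n ω = k}) P := by
    rw [iIndepSet_iff_meas_biInter hm]
    intro s
    exact hind.meas_biInter fun n _ => ⟨{k}, measurableSet_singleton k, rfl⟩
  have h2 : ∑' n, P {ω | B n ω = k} = ⊤ := by
    simp only [hunif]
    exact ENNReal.tsum_const_eq_top_of_ne_zero (by simp)
  have h3 := measure_limsup_eq_one hm h1 h2
  have h4 : MeasurableSet (limsup (fun n => {ω | B n ω = k}) atTop) :=
    MeasurableSet.measurableSet_limsup hm
  filter_upwards [(prob_compl_eq_zero_iff h4).2 h3 |> compl_mem_ae_iff.2] with ω hω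
  rw [compl_compl] at hω
  exact (mem_limsup_iff_frequently_mem (s := fun n => {ω | B n ω = k})).1 hω

/-- A limit of capacities is `0` or `1` if a subchannel that is used infinitely often moves every
intermediate capacity by a definite amount. -/
theorem limit_mem_of_frequently {g : (Fin ℓ → X) → (Fin ℓ → X)} {W : DMC X} {b : ℕ → Fin ℓ}
    {k : Fin ℓ} {c : ℝ} [Nontrivial X]
    (hstep : ∀ ε : ℝ, 0 < ε → ∃ δ : ℝ, 0 < δ ∧ ∀ V : DMC X,
      (sub g V k).symCapacity - V.symCapacity ≤ δ → V.symCapacity ≤ ε ∨ 1 - ε ≤ V.symCapacity)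
    (hlim : Tendsto (fun n => (iter g W b n).symCapacity) atTop (𝓝 c))
    (hfreq : ∃ᶠ n in atTop, b n = k) : c ∈ ({0, 1} : Set ℝ) := by
  have h0 : 0 ≤ c := ge_of_tendsto' hlim fun n => symCapacity_nonneg _
  have h1 : c ≤ 1 := le_of_tendsto' hlim fun n => symCapacity_le_one _
  have hmem : ∀ ε : ℝ, 0 < ε → c ∈ Set.Iic ε ∪ Set.Ici (1 - ε) := by
    intro ε hε
    obtain ⟨δ, hδ, hV⟩ := hstep ε hε
    have hdiff := (hlim.comp (tendsto_add_atTop_nat 1)).sub hlim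
    rw [sub_self] at hdiff
    refine (isClosed_Iic.union isClosed_Ici).mem_of_frequently_of_tendsto ?_ hlim
    refine (hfreq.and_eventually (hdiff.eventually_le_const hδ)).mono fun n hn => ?_
    refine hV _ ?_
    rw [← hn.1]
    exact hn.2
  by_contra hc
  simp only [Set.mem_insert_iff, Set.mem_singleton_iff, not_or] at hc
  have h0' : 0 < c := lt_of_le_of_ne h0 (Ne.symm hc.1)
  have h1' : c < 1 := lt_of_le_of_ne h1 hc.2
  have hm := lt_min h0' (sub_pos.2 h1')
  rcases hmem (min c (1 - c) / 2) (by linarith) with h | h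
  · have := min_le_left c (1 - c)
    simp only [Set.mem_Iic] at h
    linarith
  · have := min_le_right c (1 - c)
    simp only [Set.mem_Ici] at h
    linarith

end Martingale

end DMC

/-! ### Polarization -/

theorem mainTheorem2
    {X : Type u} [Field X] [Fintype X] [DecidableEq X]
    {ℓ : ℕ} (G : Matrix (Fin ℓ) (Fin ℓ) X)
    (hdet : IsUnit G.det)
    (hlower : ∀ i j : Fin ℓ, i < j → G i j = 0)
    (hdiag : ¬ G.IsDiag)
    (k : Fin ℓ)
    (hk : IsGreatest {i : Fin ℓ | 1 < (Finset.univ.filter fun j => G i j ≠ 0).card} k)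
    (hprim : ∃ j : Fin ℓ, j < k ∧ IsPrimitiveElement (G k j / G k k))
    (W : DMC X)
    {Ω : Type*} [MeasurableSpace Ω] (P : Measure Ω) [IsProbabilityMeasure P]
    (B : ℕ → Ω → Fin ℓ)
    (hBmeas : ∀ n, Measurable (B n))
    (hBindep : iIndepFun B P)
    (hBunif : ∀ n i, P {ω | B n ω = i} = (ℓ : ENNReal)⁻¹) :
    ∃ Iinf : Ω → ℝ, Measurable Iinf ∧
      (∀ᵐ ω ∂P, Tendsto
        (fun n : ℕ => (DMC.iter (linearKernel G) W (fun t => B t ω) n).symCapacity)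
        atTop (𝓝 (Iinf ω))) ∧
      P {ω | Iinf ω ∈ ({0, 1} : Set ℝ)} = 1 := by
  obtain ⟨j, hjk, hj⟩ := hprim
  have hne : ∀ i, G i i ≠ 0 := by
    have h := hdet.ne_zero
    rw [Matrix.det_of_isLowerTriangular G fun i j hij => hlower i j hij] at h
    exact fun i => Finset.prod_ne_zero_iff.1 h i (Finset.mem_univ i)
  -- By maximality of `k`, the rows below the `k`-th are diagonal.
  have hrow : ∀ i, k < i → ∀ j, j ≠ i → G i j = 0 := by
    intro i hi j hji
    by_contra h
    refine hi.not_ge (hk.2 (Finset.one_lt_card.2 ⟨j, ?_, i, ?_, hji⟩))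
    · simpa using h
    · simpa using hne i
  have hg : Function.Bijective (linearKernel G) :=
    ⟨Matrix.vecMul_injective_of_isUnit ((Matrix.isUnit_iff_isUnit_det G).2 hdet),
      Matrix.vecMul_surjective_iff_isUnit.2 ((Matrix.isUnit_iff_isUnit_det G).2 hdet)⟩
  set I : ℕ → Ω → ℝ := fun n ω =>
    (DMC.iter (linearKernel G) W (fun t => B t ω) n).symCapacity with hI
  have hmart : Martingale I (DMC.history B hBmeas) P :=
    DMC.martingale_symCapacity P hg W hBmeas hBindep hBunif
  have hbdd : ∀ n, eLpNorm (I n) 1 P ≤ (1 : NNReal) := by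
    intro n
    refine (eLpNorm_le_of_ae_bound (C := 1) (ae_of_all _ fun ω => ?_)).trans (by simp)
    rw [Real.norm_of_nonneg (DMC.symCapacity_nonneg _)]
    exact DMC.symCapacity_le_one _
  obtain ⟨Iinf, hmeas, hlim⟩ : ∃ Iinf : Ω → ℝ, Measurable Iinf ∧
      ∀ᵐ ω ∂P, Tendsto (fun n => I n ω) atTop (𝓝 (Iinf ω)) :=
    ⟨_, Filtration.stronglyMeasurable_limit_process'.measurable,
      hmart.submartingale.ae_tendsto_limitProcess hbdd⟩
  refine ⟨Iinf, hmeas, hlim, ?_⟩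
  have hset : MeasurableSet {ω | Iinf ω ∈ ({0, 1} : Set ℝ)} :=
    hmeas (Set.Finite.measurableSet (by simp))
  refine (prob_compl_eq_zero_iff hset).1 (compl_mem_ae_iff.1 ?_)
  rw [compl_compl]
  filter_upwards [hlim, DMC.ae_frequently_eq P hBmeas hBindep hBunif k] with ω h1 h2
  exact DMC.limit_mem_of_frequently
    (fun ε hε => DMC.exists_symCapacity_le_or_ge G hg hlower hne hrow hjk hj hε) h1 h2
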